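/- Let $X$ be a finite nonempty set, let $\langle X\rangle$ be the free monoid on $X$, with word length $|\cdot|$ (so $|1|=0$), let $R\subseteq \langle X\rangle\times\langle X\rangle$ be such that $\{|a|-|b| : (a,b)\in R\}\subseteq\mathbb Z$ is finite, and let $M=\langle X\mid R\rangle$ be the monoid generated by $X$ subject to the relations $a=b$, $(a,b)\in R$. For $a,b\in\langle X\rangle$ write $a=_M b$ if $a$ and $b$ represent the same element of $M$, and let $\mathsf L_M(a)=\{|b| : b\in\langle X\rangle,\ a=_M b\}$. The monoid $M$ (with this presentation) is called BF if $\mathsf L_M(a)$ is finite for every $a\in\langle X\rangle$. For $k\in\mathbb N$ let $\mathcal U_k=\bigcup\{\mathsf L_M(a) : a\in\langle X\rangle,\ k\in\mathsf L_M(a)\}$ (which contains $k$), $\rho_k=\sup\mathcal U_k\in\mathbb N\cup\{\infty\}$ and $\lambda_k=\min\mathcal U_k\in\mathbb N$. Intervals are intervals of integers. We say that $M$ satisfies the Structure Theorem for Unions if there are integers $d,k^*\ge 1$ and $m\ge 0$ such that for all $k\ge k^*$ $$(k+d\mathbb Z)\cap[\lambda_k+m,\ \rho_k-m]\ \subseteq\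 \mathcal U_k\ \subseteq\ k+d\mathbb Z,$$ where $[\lambda_k+m,\rho_k-m]$ means $\{l\in\mathbb Z : l\ge\lambda_k+m\}$ if $\rho_k=\infty$. We say that $M$ satisfies the Strong Structure Theorem for Unions if it satisfies the Structure Theorem for Unions and there is an integer $n\ge 1$ such that for every integer $m\ge 0$ there is an integer $k^*\ge 1$ such that for all $k\ge k^*$ $$(\rho_k-\mathcal U_k)\cap[0,m]=(\rho_{k+n}-\mathcal U_{k+n})\cap[0,m]\quad\text{and}\quad(\mathcal U_k-\lambda_k)\cap[0,m]=(\mathcal U_{k+n}-\lambda_{k+n})\cap[0,m],$$ where $\rho_k-\mathcal U_k$ means $\{\rho_k-l : l\in\mathcal U_k\}$ (read as the empty set if $\rho_k=\infty$) and $\mathcal U_k-\lambda_k=\{l-\lambda_k : l\in\mathcal U_k\}$. Theorem. Suppose that $M$ is normalizing ($aM=Ma$ for all $a\in M$) and cancellative (for all $a,b,c\in M$, each of $ab=ac$ and $ba=ca$ implies $b=c$). Then $M$ satisfies the Structure Theorem for Unions. If $M$ is moreover BF, then $M$ satisfies the Strong Structure Theorem for Unions. -/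

import Mathlib

namespace LengthFactorization

/-! ### Collections of sets of natural numbers -/

/-- `𝒰_k(𝓛)`: the union of all members of `𝓛` that contain `k`. -/
def unionOf (𝓛 : Set (Set ℕ)) (k : ℕ) : Set ℕ :=
  ⋃₀ {L | L ∈ 𝓛 ∧ k ∈ L}

/-- `ρ_k(𝓛) = sup 𝒰_k(𝓛) ∈ ℕ ∪ {∞}`. -/
noncomputable def rho (𝓛 : Set (Set ℕ)) (k : ℕ) : ℕ∞ :=
  ⨆ l ∈ unionOf 𝓛 k, (l : ℕ∞)

/-- `λ_k(𝓛) = min 𝒰_k(𝓛)` (only used when `𝒰_k(𝓛)` is nonempty). -/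
noncomputable def lam (𝓛 : Set (Set ℕ)) (k : ℕ) : ℕ :=
  sInf (unionOf 𝓛 k)

/-- The residue class `k + dℤ`. -/
def residueClass (k d : ℕ) : Set ℤ :=
  {l | ∃ z : ℤ, l = (k : ℤ) + (d : ℤ) * z}

/-- The integer interval `[λ_k + m, ρ_k - m]`; the upper bound is void if `ρ_k = ∞`. -/
def middle (𝓛 : Set (Set ℕ)) (k m : ℕ) : Set ℤ :=
  {l | (lam 𝓛 k : ℤ) + (m : ℤ) ≤ l ∧
    ∀ r : ℕ, rho 𝓛 k = (r : ℕ∞) → l ≤ (r : ℤ) - (m : ℤ)}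

/-- The Structure Theorem for Unions, as a property of a collection of sets of naturals. -/
def StructureForUnions (𝓛 : Set (Set ℕ)) : Prop :=
  ∃ d kStar m : ℕ, 0 < d ∧ 0 < kStar ∧ ∀ k : ℕ, kStar ≤ k →
    residueClass k d ∩ middle 𝓛 k m ⊆ (fun l : ℕ => (l : ℤ)) '' unionOf 𝓛 k ∧
    (fun l : ℕ => (l : ℤ)) '' unionOf 𝓛 k ⊆ residueClass k d

/-- `(ρ_k - 𝒰_k) ∩ [0, m]`. -/
def upperEnd (𝓛 : Set (Set ℕ)) (k m : ℕ) : Set ℕ :=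
  {j | j ≤ m ∧ ∃ l ∈ unionOf 𝓛 k, rho 𝓛 k = (l : ℕ∞) + (j : ℕ∞)}

/-- `(𝒰_k - λ_k) ∩ [0, m]`. -/
def lowerEnd (𝓛 : Set (Set ℕ)) (k m : ℕ) : Set ℕ :=
  {j | j ≤ m ∧ ∃ l ∈ unionOf 𝓛 k, l = lam 𝓛 k + j}

/-- The Strong Structure Theorem for Unions: in addition there is one period `n` such that, for
every `m`, the upper and lower ends of width `m` of the sets `𝒰_k` are `n`-periodic in `k` from
some point on. -/
def StrongStructureForUnions (𝓛 : Set (Set ℕ)) : Prop :=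
  StructureForUnions 𝓛 ∧
  ∃ n : ℕ, 0 < n ∧ ∀ m : ℕ, ∃ kStar : ℕ, 0 < kStar ∧ ∀ k : ℕ, kStar ≤ k →
    upperEnd 𝓛 k m = upperEnd 𝓛 (k + n) m ∧
    lowerEnd 𝓛 k m = lowerEnd 𝓛 (k + n) m

/-! ### Monoids with a presentation `⟨X | R⟩` -/

/-- `Z_M(a)`: the words that represent the same element of `M = ⟨X | R⟩` as `a`. -/
def factorizations {X : Type*} (R : FreeMonoid X → FreeMonoid X → Prop) (a : FreeMonoid X) :
    Set (FreeMonoid X) :=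
  {b | PresentedMonoid.mk R a = PresentedMonoid.mk R b}

/-- `L_M(a)`: the lengths of the words in `Z_M(a)`. -/
def lengthSet {X : Type*} (R : FreeMonoid X → FreeMonoid X → Prop) (a : FreeMonoid X) : Set ℕ :=
  FreeMonoid.length '' factorizations R a

/-- `𝓛(M)`: the system of sets of lengths of `M = ⟨X | R⟩`. -/
def lengthSystem {X : Type*} (R : FreeMonoid X → FreeMonoid X → Prop) : Set (Set ℕ) :=
  Set.range (lengthSet R)

/-- `⟨X | R⟩` is a bounded factorization (BF) monoid: every length set is finite. -/
def IsBF {X : Type*} (R : FreeMonoid X → FreeMonoid X → Prop) : Prop :=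
  ∀ a : FreeMonoid X, (lengthSet R a).Finite

/-- A monoid is normalizing if `aM = Ma` for all `a`. -/
def IsNormalizing (M : Type*) [Monoid M] : Prop :=
  ∀ a : M, Set.range (fun m : M => a * m) = Set.range (fun m : M => m * a)

end LengthFactorization

namespace LengthFactorization

/-! ### Stabilisation of shift-monotone sequences -/

/-! The pairs `(k, l)` with `l ∈ 𝒰_k` form a symmetric submonoid of `ℕ × ℕ` containing the diagonal,
and their differences form a subgroup `dℤ`. One use of a relation changes length by at most some
`D`, so the unions have gaps at most `D`. Adding `D` pairs of the form `(A, A + d)` or `(A, A)`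
closes these gaps (`IsSubadditive.fill`) and raises the index by `D * A`; the Structure Theorem
follows once the ends of `𝒰_{k+c}` stay within bounded distance of those of `𝒰_k` (`IsClose`).

If `M` is not BF, some union is infinite; then `ρ_k = ∞` and, by symmetry, `λ_k` is bounded for
large `k`.

If `M` is BF, the slopes `l / k` have an attained maximum `q / p`. Hence `ρ_{k+p} = ρ_k + q` and
`λ_{k+q} = λ_k + p` eventually, which gives closeness and periodic ends. To attain the maximum: `M`
is generated by finitely many irreducibles, so `N = |Aut M|` is finite. Conjugations are
automorphisms, so `N`-th powers are central, and a long word splits off some `x ^ N`. Every word is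
thus a central monomial times a short remainder; Dickson's lemma and cancellation reduce all pairs
to finitely many. -/

theorem exists_forall_ge_shift_eq {α : Type*} [PartialOrder α] [WellFoundedGT α] {p : ℕ}
    (hp : 0 < p) (g : ℕ → α) (k₀ : ℕ) (hg : ∀ k, k₀ ≤ k → g k ≤ g (k + p)) :
    ∃ k₁, k₀ ≤ k₁ ∧ ∀ k, k₁ ≤ k → g (k + p) = g k := by
  have key : ∀ i : ℕ, ∃ n, ∀ m, n ≤ m → g (k₀ + i + p * n) = g (k₀ + i + p * m) := by
    intro i
    have hmono : Monotone fun j : ℕ => g (k₀ + i + p * j) := by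
      refine monotone_nat_of_le_succ fun j => ?_
      have := hg (k₀ + i + p * j) (by omega)
      rwa [show k₀ + i + p * j + p = k₀ + i + p * (j + 1) by ring] at this
    exact WellFoundedGT.monotone_chain_condition ⟨_, hmono⟩
  choose n hn using key
  -- The sum bounds the thresholds of all `p` residue classes at once.
  refine ⟨k₀ + p * (∑ i ∈ Finset.range p, n i + 1), by omega, fun k hk => ?_⟩
  obtain ⟨e, rfl⟩ : ∃ e, k = k₀ + e := ⟨k - k₀, by omega⟩
  have hlt : e % p < p := Nat.mod_lt _ hp
  have hle : n (e % p) ≤ e / p := by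
    have h1 : n (e % p) ≤ ∑ i ∈ Finset.range p, n i :=
      Finset.single_le_sum (f := n) (fun _ _ => Nat.zero_le _) (Finset.mem_range.2 hlt)
    have h2 : ∑ i ∈ Finset.range p, n i + 1 ≤ e / p := by
      rw [Nat.le_div_iff_mul_le hp, mul_comm]; omega
    omega
  have h1 := hn _ _ hle
  have h2 := hn (e % p) (e / p + 1) (by omega)
  have e1 : k₀ + e % p + p * (e / p) = k₀ + e := by rw [add_assoc, Nat.mod_add_div]
  have e2 : k₀ + e % p + p * (e / p + 1) = k₀ + e + p := by rw [Nat.mul_succ]; omega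
  rw [e1] at h1; rw [e2] at h2
  exact h2.symm.trans h1

/-- The defect `q * k - p * f k` is nonnegative and never grows under `k ↦ k + p`, so it stabilises
on each residue class. -/
theorem exists_forall_ge_add_eq {p : ℕ} (hp : 0 < p) {q : ℤ} (f : ℕ → ℤ)
    (hf : ∀ k, f k + q ≤ f (k + p)) (hb : ∀ k, p * f k ≤ q * k) :
    ∃ k₁, ∀ k, k₁ ≤ k → f (k + p) = f k + q := by
  have hg : ∀ k : ℕ, 0 ≤ q * k - p * f k := fun k => by linarith [hb k]
  obtain ⟨k₁, -, h⟩ := exists_forall_ge_shift_eq (α := ℕᵒᵈ) hp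
    (fun k => OrderDual.toDual (q * k - p * f k).toNat) 0 (by
      intro k _
      refine OrderDual.toDual_le_toDual.2 (Int.toNat_le_toNat ?_)
      push_cast
      nlinarith [hf k])
  refine ⟨k₁, fun k hk => ?_⟩
  have h1 := congrArg Int.ofNat (OrderDual.toDual_inj.1 (h k hk))
  simp only [Int.ofNat_eq_natCast, Int.toNat_of_nonneg (hg _)] at h1
  push_cast at h1
  have hp' : (p : ℤ) ≠ 0 := by exact_mod_cast hp.ne'
  apply mul_left_cancel₀ hp'
  linarith

theorem shift_mul_eq {α : Type*} {p k₁ : ℕ} {g : ℕ → α} (h : ∀ k, k₁ ≤ k → g (k + p) = g k) (j : ℕ)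
    {k : ℕ} (hk : k₁ ≤ k) : g (k + p * j) = g k := by
  induction j with
  | zero => simp
  | succ j ih => rw [Nat.mul_succ, ← add_assoc, h _ (by omega), ih]

/-! ### Subadditive collections -/

/-- The unions of `𝓛` are the fibres of a submonoid of `ℕ × ℕ` that contains the diagonal. -/
structure IsSubadditive (𝓛 : Set (Set ℕ)) : Prop where
  self_mem : ∀ k, k ∈ unionOf 𝓛 k
  add_mem : ∀ {k k' l l'}, l ∈ unionOf 𝓛 k → l' ∈ unionOf 𝓛 k' → l + l' ∈ unionOf 𝓛 (k + k')

/-- The unions of `𝓛` have gaps of length at most `D`. -/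
def HasGapsLE (𝓛 : Set (Set ℕ)) (D : ℕ) : Prop :=
  ∀ ⦃k l₁ l₂ t⦄, l₁ ∈ unionOf 𝓛 k → l₂ ∈ unionOf 𝓛 k → l₁ ≤ t → t ≤ l₂ →
    ∃ l ∈ unionOf 𝓛 k, l ≤ t ∧ t ≤ l + D

/-- The elasticity of `𝓛` is `q / p` and it is attained. -/
structure IsElasticity (𝓛 : Set (Set ℕ)) (p q : ℕ) : Prop where
  pos_left : 0 < p
  pos_right : 0 < q
  mem : q ∈ unionOf 𝓛 p
  mul_le : ∀ {k l}, l ∈ unionOf 𝓛 k → p * l ≤ q * k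

/-- The unions with index `k + c` are close to those with index `k`. -/
def IsClose (𝓛 : Set (Set ℕ)) (c : ℕ) : Prop :=
  ∃ C k₁ : ℕ, ∀ k, k₁ ≤ k → ∀ l ∈ unionOf 𝓛 (k + c),
    (∃ l' ∈ unionOf 𝓛 k, l ≤ l' + C) ∧ ∃ l' ∈ unionOf 𝓛 k, l' ≤ l + C

variable {𝓛 : Set (Set ℕ)}

theorem mem_unionOf_comm {k l : ℕ} : l ∈ unionOf 𝓛 k ↔ k ∈ unionOf 𝓛 l := by
  simp only [unionOf, Set.mem_sUnion, Set.mem_ofPred_eq]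
  constructor <;> rintro ⟨L, ⟨h1, h2⟩, h3⟩ <;> exact ⟨L, ⟨h1, h3⟩, h2⟩

theorem IsSubadditive.mul_mem (h : IsSubadditive 𝓛) {k l : ℕ} (hl : l ∈ unionOf 𝓛 k) (j : ℕ) :
    j * l ∈ unionOf 𝓛 (j * k) := by
  induction j with
  | zero => simpa using h.self_mem 0
  | succ j ih => rw [Nat.succ_mul, Nat.succ_mul]; exact h.add_mem ih hl

/-- The differences `l - k` with `l ∈ 𝒰_k` form a subgroup of `ℤ`. -/
theorem IsSubadditive.exists_period (h : IsSubadditive 𝓛) :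
    ∃ d : ℕ, (∃ A, A + d ∈ unionOf 𝓛 A) ∧ ∀ k l, l ∈ unionOf 𝓛 k → (d : ℤ) ∣ (l : ℤ) - k := by
  let H : AddSubgroup ℤ :=
    { carrier := {z | ∃ k l, l ∈ unionOf 𝓛 k ∧ z = (l : ℤ) - k}
      zero_mem' := ⟨0, 0, h.self_mem 0, by simp⟩
      add_mem' := by
        rintro _ _ ⟨k, l, hl, rfl⟩ ⟨k', l', hl', rfl⟩
        exact ⟨k + k', l + l', h.add_mem hl hl', by push_cast; ring⟩
      neg_mem' := by
        rintro _ ⟨k, l, hl, rfl⟩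
        exact ⟨l, k, mem_unionOf_comm.1 hl, by ring⟩ }
  obtain ⟨a, ha⟩ := Int.subgroup_cyclic H
  have haH : a ∈ H := by rw [ha]; exact AddSubgroup.subset_closure rfl
  have hdH : (a.natAbs : ℤ) ∈ H := by
    rcases Int.natAbs_eq a with h1 | h1
    · rwa [← h1]
    · rw [show (a.natAbs : ℤ) = -a by omega]; exact H.neg_mem haH
  refine ⟨a.natAbs, ?_, fun k l hl => ?_⟩
  · obtain ⟨k, l, hl, e⟩ := hdH
    exact ⟨k, by rwa [show k + a.natAbs = l by omega]⟩
  · have hm : (l : ℤ) - k ∈ H := ⟨k, l, hl, rfl⟩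
    rw [ha, AddSubgroup.mem_closure_singleton] at hm
    obtain ⟨n, hn⟩ := hm
    rw [Int.natAbs_dvd, ← hn]
    exact ⟨n, by simp [mul_comm]⟩

theorem IsSubadditive.fill (h : IsSubadditive 𝓛) {d A D : ℕ} (hd : 0 < d)
    (hA : A + d ∈ unionOf 𝓛 A) (hdvd : ∀ k l, l ∈ unionOf 𝓛 k → (d : ℤ) ∣ (l : ℤ) - k)
    (hD : HasGapsLE 𝓛 D) {k l₁ l₂ t : ℕ} (h₁ : l₁ ∈ unionOf 𝓛 k) (h₂ : l₂ ∈ unionOf 𝓛 k)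
    (ht₁ : l₁ ≤ t) (ht₂ : t ≤ l₂) (ht : (d : ℤ) ∣ (t : ℤ) - k) :
    t + D * A ∈ unionOf 𝓛 (k + D * A) := by
  obtain ⟨l, hl, hlt, htl⟩ := hD h₁ h₂ ht₁ ht₂
  have hdl : d ∣ t - l := by
    have := dvd_sub ht (hdvd k l hl)
    rw [show (t : ℤ) - k - (l - k) = ((t - l : ℕ) : ℤ) by omega] at this
    exact_mod_cast this
  obtain ⟨j, hj⟩ := hdl
  have hjD : j ≤ D := (Nat.le_mul_of_pos_left j hd).trans (by omega)
  obtain ⟨i, rfl⟩ := Nat.exists_eq_add_of_le hjD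
  -- Use `j` copies of `(A, A + d)` to climb from `l` to `t`, and `D - j` diagonal pairs so that the
  -- index shift is always `D * A`.
  have := h.add_mem hl (h.add_mem (h.mul_mem hA j) (h.mul_mem (h.self_mem A) i))
  rw [show t = l + d * j by omega, show l + d * j + (j + i) * A = l + (j * (A + d) + i * A) by ring,
    add_mul j i]
  exact this

theorem lam_mem (h : IsSubadditive 𝓛) (k : ℕ) : lam 𝓛 k ∈ unionOf 𝓛 k :=
  Nat.sInf_mem ⟨k, h.self_mem k⟩

theorem lam_le {k l : ℕ} (hl : l ∈ unionOf 𝓛 k) : lam 𝓛 k ≤ l := Nat.sInf_le hl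

theorem rho_eq_of_isGreatest {k r : ℕ} (h : IsGreatest (unionOf 𝓛 k) r) : rho 𝓛 k = r := by
  refine le_antisymm (iSup₂_le fun l hl => ?_) (le_iSup₂_of_le r h.1 le_rfl)
  exact_mod_cast h.2 hl

theorem exists_isGreatest_of_bddAbove (h : IsSubadditive 𝓛) {k : ℕ}
    (hb : BddAbove (unionOf 𝓛 k)) : IsGreatest (unionOf 𝓛 k) (sSup (unionOf 𝓛 k)) :=
  ⟨Nat.sSup_mem ⟨k, h.self_mem k⟩ hb, fun _ hl => le_csSup hb hl⟩

theorem structureForUnions_of_isClose (h : IsSubadditive 𝓛) {D : ℕ} (hD : HasGapsLE 𝓛 D)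
    (hclose : ∀ c, IsClose 𝓛 c) : StructureForUnions 𝓛 := by
  obtain ⟨d, ⟨A, hA⟩, hdvd⟩ := h.exists_period
  -- For `d = 0` every union is a singleton, and the period `1` serves instead.
  rcases Nat.eq_zero_or_pos d with rfl | hd
  · have hU : ∀ k, unionOf 𝓛 k = {k} := fun k => by
      ext l
      refine ⟨fun hl => ?_, fun hl => by rw [hl]; exact h.self_mem k⟩
      have := hdvd k l hl
      rw [Nat.cast_zero, zero_dvd_iff] at this
      exact Set.mem_singleton_iff.2 (by omega)
    refine ⟨1, 1, 0, one_pos, one_pos, fun k _ => ⟨?_, ?_⟩⟩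
    · rintro l ⟨-, h1, h2⟩
      have h2 := h2 k (rho_eq_of_isGreatest (by rw [hU]; exact isGreatest_singleton))
      have h3 : lam 𝓛 k = k := by simpa [hU] using lam_mem h k
      exact ⟨k, h.self_mem k, by push_cast at *; omega⟩
    · rintro _ ⟨l, -, rfl⟩
      exact ⟨(l : ℤ) - k, by simp⟩
  · obtain ⟨C, k₁, hC⟩ := hclose (D * A)
    -- In the margin, `C` pays for passing from index `k` to `k - D * A`, and `D * A` for the shift
    -- made by filling.
    refine ⟨d, k₁ + D * A + 1, C + D * A, hd, by omega, fun k hk => ⟨?_, ?_⟩⟩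
    · rintro t ⟨⟨z, hz⟩, h1, h2⟩
      push_cast at h1 h2
      obtain ⟨e, rfl⟩ : ∃ e, k = e + D * A := ⟨k - D * A, by omega⟩
      obtain ⟨s, rfl⟩ : ∃ s : ℕ, t = ((s + D * A : ℕ) : ℤ) :=
        ⟨(t - (D * A : ℕ)).toNat, by push_cast; omega⟩
      have hup : ∃ l ∈ unionOf 𝓛 (e + D * A), s + C ≤ l := by
        by_cases hb : BddAbove (unionOf 𝓛 (e + D * A))
        · have hg := exists_isGreatest_of_bddAbove h hb
          refine ⟨_, hg.1, ?_⟩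
          have := h2 _ (rho_eq_of_isGreatest hg)
          push_cast at this
          omega
        · obtain ⟨l, hl, hlt⟩ := not_bddAbove_iff.1 hb (s + C)
          exact ⟨l, hl, hlt.le⟩
      obtain ⟨l, hl, hsl⟩ := hup
      obtain ⟨l₂, hl₂, hll₂⟩ := (hC e (by omega) l hl).1
      obtain ⟨l₁, hl₁, hll₁⟩ := (hC e (by omega) _ (lam_mem h (e + D * A))).2
      refine ⟨s + D * A, h.fill hd hA hdvd hD hl₁ hl₂ (by push_cast at h1; omega) (by omega) ?_, rfl⟩
      refine ⟨z, ?_⟩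
      push_cast at hz
      linarith
    · rintro _ ⟨l, hl, rfl⟩
      obtain ⟨z, hz⟩ := hdvd k l hl
      exact ⟨z, by simp only; linarith⟩

theorem isClose_of_infinite (h : IsSubadditive 𝓛) {D : ℕ} (hD : HasGapsLE 𝓛 D) {k₀ : ℕ}
    (hinf : (unionOf 𝓛 k₀).Infinite) (c : ℕ) : IsClose 𝓛 c := by
  have hunb : ∀ k, k₀ ≤ k → ∀ t, ∃ l ∈ unionOf 𝓛 k, t ≤ l := fun k hk t => by
    obtain ⟨l, hl, hlt⟩ := hinf.exists_gt t
    refine ⟨l + (k - k₀), ?_, by omega⟩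
    have := h.add_mem hl (h.self_mem (k - k₀))
    rwa [show k₀ + (k - k₀) = k by omega] at this
  obtain ⟨d, ⟨A, hA⟩, hdvd⟩ := h.exists_period
  have hd : 0 < d := by
    by_contra hd
    obtain ⟨l, hl, hlt⟩ := hinf.exists_gt k₀
    obtain ⟨z, hz⟩ := hdvd k₀ l hl
    rw [show d = 0 by omega] at hz
    simp only [Nat.cast_zero, zero_mul] at hz
    omega
  refine ⟨k₀ + D * A + d, k₀ + D * A, fun k hk l hl => ⟨?_, ?_⟩⟩
  · obtain ⟨l', hl', hll'⟩ := hunb k (by omega) l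
    exact ⟨l', hl', by omega⟩
  · obtain ⟨e, rfl⟩ : ∃ e, k = k₀ + e + D * A := ⟨k - k₀ - D * A, by omega⟩
    -- Filling puts `k` into the union of the bounded index `k₀ + e % d + D * A`; by symmetry that
    -- index lies in `𝒰_k`, bounding `λ_k`.
    obtain ⟨l₂, hl₂, hle⟩ := hunb (k₀ + e % d) (by omega) (k₀ + e)
    have hmod := Nat.mod_add_div e d
    have := h.fill hd hA hdvd hD (h.self_mem (k₀ + e % d)) hl₂
      (by have := Nat.mod_le e d; omega) hle ⟨(e / d : ℕ), by
        have : (e : ℤ) = (e % d : ℕ) + d * (e / d : ℕ) := by exact_mod_cast hmod.symm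
        rw [Nat.cast_add, Nat.cast_add]; linarith⟩
    exact ⟨_, mem_unionOf_comm.1 this, by have := Nat.mod_lt e hd; omega⟩

/-! ### Consequences of an attained elasticity -/

section Elasticity

variable {p q : ℕ}

theorem IsElasticity.bddAbove (he : IsElasticity 𝓛 p q) (k : ℕ) : BddAbove (unionOf 𝓛 k) :=
  ⟨q * k, fun l hl => by nlinarith [he.mul_le hl, he.pos_left]⟩

theorem IsElasticity.sSup_add_eq (h : IsSubadditive 𝓛) (he : IsElasticity 𝓛 p q) :
    ∃ k₁, ∀ k, k₁ ≤ k → sSup (unionOf 𝓛 (k + p)) = sSup (unionOf 𝓛 k) + q := by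
  have hg := fun k => exists_isGreatest_of_bddAbove h (he.bddAbove k)
  obtain ⟨k₁, h₁⟩ := exists_forall_ge_add_eq he.pos_left (q := q)
    (fun k => ((sSup (unionOf 𝓛 k) : ℕ) : ℤ))
    (fun k => by exact_mod_cast (hg _).2 (h.add_mem (hg k).1 he.mem))
    (fun k => by exact_mod_cast he.mul_le (hg k).1)
  exact ⟨k₁, fun k hk => by exact_mod_cast h₁ k hk⟩

theorem IsElasticity.lam_add_eq (h : IsSubadditive 𝓛) (he : IsElasticity 𝓛 p q) :
    ∃ k₁, ∀ k, k₁ ≤ k → lam 𝓛 (k + q) = lam 𝓛 k + p := by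
  obtain ⟨k₁, h₁⟩ := exists_forall_ge_add_eq he.pos_right (q := -p)
    (fun k => -((lam 𝓛 k : ℕ) : ℤ))
    (fun k => by
      have := lam_le (h.add_mem (lam_mem h k) (mem_unionOf_comm.1 he.mem))
      zify at this
      linarith)
    (fun k => by
      have := he.mul_le (mem_unionOf_comm.1 (lam_mem h k))
      zify at this
      linarith)
  refine ⟨k₁, fun k hk => ?_⟩
  have := h₁ k hk
  zify
  linarith

theorem IsElasticity.isClose (h : IsSubadditive 𝓛) (he : IsElasticity 𝓛 p q) (c : ℕ) :
    IsClose 𝓛 c := by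
  obtain ⟨k₁, h₁⟩ := he.sSup_add_eq h
  obtain ⟨k₂, h₂⟩ := he.lam_add_eq h
  have hg := fun k => exists_isGreatest_of_bddAbove h (he.bddAbove k)
  have H₁ : ∀ j k, k₁ ≤ k → sSup (unionOf 𝓛 (k + j * p)) = sSup (unionOf 𝓛 k) + j * q := by
    intro j k hk
    induction j with
    | zero => simp
    | succ j ih => rw [Nat.succ_mul, ← add_assoc, h₁ _ (by omega), ih, Nat.succ_mul, add_assoc]
  have H₂ : ∀ j k, k₂ ≤ k → lam 𝓛 (k + j * q) = lam 𝓛 k + j * p := by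
    intro j k hk
    induction j with
    | zero => simp
    | succ j ih => rw [Nat.succ_mul, ← add_assoc, h₂ _ (by omega), ih, Nat.succ_mul, add_assoc]
  -- Diagonal pairs pad the index `k + c` to `k + c * p` or `k + c * q`, where the ends are known
  -- exactly.
  refine ⟨c * q, k₁ + k₂, fun k hk l hl => ⟨⟨_, (hg k).1, ?_⟩, ⟨_, lam_mem h k, ?_⟩⟩⟩
  · have hcp : c ≤ c * p := Nat.le_mul_of_pos_right c he.pos_left
    have := (hg _).2 (h.add_mem hl (h.self_mem (c * p - c)))
    rw [show k + c + (c * p - c) = k + c * p by omega, H₁ c k (by omega)] at this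
    omega
  · have hcq : c ≤ c * q := Nat.le_mul_of_pos_right c he.pos_right
    have := lam_le (h.add_mem hl (h.self_mem (c * q - c)))
    rw [show k + c + (c * q - c) = k + c * q by omega, H₂ c k (by omega)] at this
    omega

theorem exists_forall_ge_shift_eq_of_subset {m : ℕ} (hp : 0 < p) (S : ℕ → Set ℕ)
    (hS : ∀ k, ∀ j ∈ S k, j ≤ m) (k₀ : ℕ) (hsub : ∀ k, k₀ ≤ k → S k ⊆ S (k + p)) :
    ∃ k₁, ∀ k, k₁ ≤ k → S (k + p) = S k := by
  obtain ⟨k₁, hk₁, h⟩ := exists_forall_ge_shift_eq hp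
    (fun k => {j : Fin (m + 1) | (j : ℕ) ∈ S k}) k₀ (fun k hk j hj => hsub k hk hj)
  refine ⟨k₁, fun k hk => Set.Subset.antisymm (fun j hj => ?_) (hsub k (by omega))⟩
  have hj' : (⟨j, Nat.lt_succ_of_le (hS _ j hj)⟩ : Fin (m + 1)) ∈
      {j : Fin (m + 1) | (j : ℕ) ∈ S (k + p)} := hj
  rw [h k hk] at hj'
  exact hj'

/-- Adding `(p, q)` eventually embeds upper ends and `(q, p)` lower ends; subsets of `[0, m]` can
grow only finitely often. A common period is `p * q`. -/
theorem IsElasticity.strongStructureForUnions (h : IsSubadditive 𝓛) {D : ℕ} (hD : HasGapsLE 𝓛 D)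
    (he : IsElasticity 𝓛 p q) : StrongStructureForUnions 𝓛 := by
  refine ⟨structureForUnions_of_isClose h hD (he.isClose h), p * q,
    Nat.mul_pos he.pos_left he.pos_right, fun m => ?_⟩
  obtain ⟨k₁, h₁⟩ := he.sSup_add_eq h
  obtain ⟨k₂, h₂⟩ := he.lam_add_eq h
  have hrho : ∀ k, rho 𝓛 k = (sSup (unionOf 𝓛 k) : ℕ) := fun k =>
    rho_eq_of_isGreatest (exists_isGreatest_of_bddAbove h (he.bddAbove k))
  obtain ⟨k₃, h₃⟩ := exists_forall_ge_shift_eq_of_subset he.pos_left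
    (fun k => upperEnd 𝓛 k m) (fun _ _ hj => hj.1) k₁ (by
      rintro k hk j ⟨hj, l, hl, e⟩
      refine ⟨hj, l + q, h.add_mem hl he.mem, ?_⟩
      rw [hrho] at e ⊢
      rw [h₁ k hk, Nat.cast_add, e]
      push_cast
      ring)
  obtain ⟨k₄, h₄⟩ := exists_forall_ge_shift_eq_of_subset he.pos_right
    (fun k => lowerEnd 𝓛 k m) (fun _ _ hj => hj.1) k₂ (by
      rintro k hk j ⟨hj, l, hl, e⟩
      refine ⟨hj, l + p, h.add_mem hl (mem_unionOf_comm.1 he.mem), ?_⟩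
      rw [h₂ k hk, e]
      ring)
  refine ⟨k₃ + k₄ + 1, by omega, fun k hk => ⟨?_, ?_⟩⟩
  · exact (shift_mul_eq (g := fun k => upperEnd 𝓛 k m) h₃ q (show k₃ ≤ k by omega)).symm
  · rw [mul_comm]
    exact (shift_mul_eq (g := fun k => lowerEnd 𝓛 k m) h₄ p (show k₄ ≤ k by omega)).symm

/-- The elasticity is attained if the pairs `(k, l)` with `l ∈ 𝒰_k` are generated by finitely many
of them. -/
theorem IsSubadditive.exists_isElasticity (h : IsSubadditive 𝓛) (h0 : unionOf 𝓛 0 ⊆ {0})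
    {F : Set (ℕ × ℕ)} (hfin : F.Finite) (hF : ∀ f ∈ F, f.2 ∈ unionOf 𝓛 f.1 ∧ 0 < f.1)
    (hgen : ∀ k l, l ∈ unionOf 𝓛 k → 0 < k →
      ∃ f ∈ F, ∃ k' l', l' ∈ unionOf 𝓛 k' ∧ k = f.1 + k' ∧ l = f.2 + l') :
    ∃ p q, IsElasticity 𝓛 p q := by
  obtain ⟨f₀, hf₀, -⟩ := hgen 1 1 (h.self_mem 1) one_pos
  -- A generator of maximal slope: sums of pairs cannot exceed it.
  obtain ⟨⟨p, q⟩, hpq, hmax⟩ :=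
    Set.exists_max_image F (fun f => (f.2 : ℚ) / f.1) hfin ⟨f₀, hf₀⟩
  obtain ⟨hmem, hp⟩ := hF _ hpq
  have hmax' : ∀ f ∈ F, p * f.2 ≤ q * f.1 := fun f hf => by
    have h1 := hmax f hf
    have hp' : (0 : ℚ) < p := by exact_mod_cast hp
    have hf' : (0 : ℚ) < f.1 := by exact_mod_cast (hF f hf).2
    rw [div_le_div_iff₀ hf' hp'] at h1
    have : f.2 * p ≤ q * f.1 := by exact_mod_cast h1
    linarith
  refine ⟨p, q, hp, ?_, hmem, ?_⟩
  · refine Nat.pos_of_ne_zero fun hq => hp.ne' (h0 ?_)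
    have := mem_unionOf_comm.1 hmem
    rwa [show ((p, q) : ℕ × ℕ).2 = 0 from hq] at this
  · intro k
    induction k using Nat.strong_induction_on with
    | _ k ih =>
      intro l hl
      rcases Nat.eq_zero_or_pos k with rfl | hk
      · rw [h0 hl]; simp
      · obtain ⟨f, hf, k', l', hl', rfl, rfl⟩ := hgen k l hl hk
        have h1 := ih k' (by have := (hF f hf).2; omega) hl'
        have h2 := hmax' f hf
        rw [mul_add, mul_add]
        exact Nat.add_le_add h2 h1

end Elasticity

end LengthFactorization
namespace LengthFactorization

/-! ### Normalizing cancellative monoids -/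

section Monoid

variable {M : Type*} [Monoid M]

/-- In a normalizing cancellative monoid, conjugation by `u` is an automorphism. -/
theorem IsNormalizing.exists_mulAut [IsCancelMul M] (h : IsNormalizing M) (u : M) :
    ∃ φ : MulAut M, ∀ m, m * u = u * φ m := by
  have hf : ∀ m, ∃ m', m * u = u * m' := fun m => by
    obtain ⟨m', hm'⟩ : m * u ∈ Set.range (fun m : M => u * m) := by rw [h u]; exact ⟨m, rfl⟩
    exact ⟨m', hm'.symm⟩
  have hg : ∀ m, ∃ m', u * m = m' * u := fun m => by
    obtain ⟨m', hm'⟩ : u * m ∈ Set.range (fun m : M => m * u) := by rw [← h u]; exact ⟨m, rfl⟩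
    exact ⟨m', hm'.symm⟩
  choose f hf using hf
  choose g hg using hg
  refine ⟨{ toFun := f, invFun := g, left_inv := fun m => ?_, right_inv := fun m => ?_,
            map_mul' := fun m n => ?_ }, hf⟩
  · exact mul_right_cancel (b := u) (by rw [← hg, ← hf])
  · exact mul_left_cancel (a := u) (by rw [← hf, ← hg])
  · exact mul_left_cancel (a := u) (by rw [← hf, mul_assoc, hf n, ← mul_assoc, hf m, mul_assoc])

/-- Automorphisms permute the irreducibles and are determined by their values there. -/
theorem finite_mulAut (hfin : {m : M | Irreducible m}.Finite)
    (hgen : Submonoid.closure {m : M | Irreducible m} = ⊤) : Finite (MulAut M) := by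
  have : Finite {m : M | Irreducible m} := hfin
  refine Finite.of_injective (fun (φ : MulAut M) (m : {m : M | Irreducible m}) =>
    (⟨φ m, (MulEquiv.irreducible_iff φ).2 m.2⟩ : {m : M | Irreducible m})) fun φ ψ h => ?_
  have : φ.toMonoidHom = ψ.toMonoidHom := MonoidHom.eq_of_eqOn_denseM hgen fun m hm =>
    congrArg Subtype.val (congrFun h ⟨m, hm⟩)
  exact MulEquiv.ext fun m => DFunLike.congr_fun this m

theorem pow_card_mulAut_mem_center [Finite (MulAut M)] {u : M} {φ : MulAut M}
    (h : ∀ m, m * u = u * φ m) : u ^ Nat.card (MulAut M) ∈ Submonoid.center M := by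
  have key : ∀ (j : ℕ) (m : M), m * u ^ j = u ^ j * (φ ^ j) m := by
    intro j
    induction j with
    | zero => simp
    | succ j ih =>
      intro m
      rw [pow_succ, ← mul_assoc, ih, mul_assoc, h, pow_succ', MulAut.mul_apply, mul_assoc]
  refine Submonoid.mem_center_iff.2 fun m => ?_
  rw [key, pow_card_eq_one', MulAut.one_apply]

end Monoid

/-! ### Presented monoids -/

section Presented

variable {X : Type*} {R : FreeMonoid X → FreeMonoid X → Prop}

theorem mk_eq_mk_iff {a b : FreeMonoid X} :
    PresentedMonoid.mk R a = PresentedMonoid.mk R b ↔ ConGen.Rel R a b :=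
  Quotient.eq

theorem mem_unionOf_lengthSystem {k l : ℕ} : l ∈ unionOf (lengthSystem R) k ↔
    ∃ a b, PresentedMonoid.mk R a = PresentedMonoid.mk R b ∧ a.length = k ∧ b.length = l := by
  constructor
  · rintro ⟨_, ⟨⟨c, rfl⟩, ⟨a, ha, rfl⟩⟩, ⟨b, hb, rfl⟩⟩
    exact ⟨a, b, ha.symm.trans hb, rfl, rfl⟩
  · rintro ⟨a, b, h, rfl, rfl⟩
    exact ⟨lengthSet R a, ⟨⟨a, rfl⟩, ⟨a, rfl, rfl⟩⟩, ⟨b, h, rfl⟩⟩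

theorem isSubadditive_lengthSystem [Nonempty X] : IsSubadditive (lengthSystem R) where
  self_mem k := by
    obtain ⟨a, ha⟩ := FreeMonoid.length_surjective (α := X) k
    exact mem_unionOf_lengthSystem.2 ⟨a, a, rfl, ha, ha⟩
  add_mem hl hl' := by
    obtain ⟨a, b, h, rfl, rfl⟩ := mem_unionOf_lengthSystem.1 hl
    obtain ⟨a', b', h', rfl, rfl⟩ := mem_unionOf_lengthSystem.1 hl'
    exact mem_unionOf_lengthSystem.2 ⟨a * a', b * b', by rw [map_mul, map_mul, h, h'],
      FreeMonoid.length_mul _ _, FreeMonoid.length_mul _ _⟩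

theorem exists_length_between {D : ℕ}
    (hD : ∀ a b, R a b → a.length ≤ b.length + D ∧ b.length ≤ a.length + D)
    {a b : FreeMonoid X} (h : ConGen.Rel R a b) (t : ℤ)
    (h₁ : min (a.length : ℤ) b.length ≤ t) (h₂ : t ≤ max (a.length : ℤ) b.length) :
    ∃ c, ConGen.Rel R a c ∧ (c.length : ℤ) ≤ t ∧ t ≤ c.length + D := by
  induction h generalizing t with
  | of a b hab =>
    have := hD a b hab
    rcases le_total a.length b.length with hl | hl
    · exact ⟨a, .refl a, by omega, by omega⟩
    · exact ⟨b, .of a b hab, by omega, by omega⟩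
  | refl a => exact ⟨a, .refl a, by omega, by omega⟩
  | symm hab ih =>
    obtain ⟨c, hc, h⟩ := ih t (by omega) (by omega)
    exact ⟨c, hab.symm.trans hc, h⟩
  | @trans a b c hab hbc ih₁ ih₂ =>
    by_cases ht : min (a.length : ℤ) b.length ≤ t ∧ t ≤ max (a.length : ℤ) b.length
    · exact ih₁ t ht.1 ht.2
    · obtain ⟨c, hc, h⟩ := ih₂ t (by omega) (by omega)
      exact ⟨c, hab.trans hc, h⟩
  | @mul a b c d hab hcd ih₁ ih₂ =>
    simp only [FreeMonoid.length_mul] at h₁ h₂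
    push_cast at h₁ h₂
    -- Pass from `a * c` to `b * d` through `b * c`; `t` lies between the lengths at one of the two
    -- stages.
    by_cases ht : min (a.length : ℤ) b.length ≤ t - c.length ∧
        t - c.length ≤ max (a.length : ℤ) b.length
    · obtain ⟨e, he, h⟩ := ih₁ _ ht.1 ht.2
      exact ⟨e * c, he.mul (.refl c), by rw [FreeMonoid.length_mul]; omega,
        by rw [FreeMonoid.length_mul]; omega⟩
    · obtain ⟨e, he, h⟩ := ih₂ (t - b.length) (by omega) (by omega)
      exact ⟨b * e, hab.mul he, by rw [FreeMonoid.length_mul]; omega,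
        by rw [FreeMonoid.length_mul]; omega⟩

theorem exists_hasGapsLE
    (hR : {z : ℤ | ∃ a b : FreeMonoid X, R a b ∧ z = (a.length : ℤ) - (b.length : ℤ)}.Finite) :
    ∃ D, HasGapsLE (lengthSystem R) D := by
  obtain ⟨D, hD⟩ := (hR.image Int.natAbs).bddAbove
  have hD' : ∀ a b, R a b → a.length ≤ b.length + D ∧ b.length ≤ a.length + D := by
    intro a b hab
    have := hD ⟨_, ⟨a, b, hab, rfl⟩, rfl⟩
    omega
  have key : ∀ {k l t : ℕ}, l ∈ unionOf (lengthSystem R) k → min k l ≤ t → t ≤ max k l →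
      ∃ l' ∈ unionOf (lengthSystem R) k, l' ≤ t ∧ t ≤ l' + D := by
    intro k l t hl h₁ h₂
    obtain ⟨a, b, h, rfl, rfl⟩ := mem_unionOf_lengthSystem.1 hl
    obtain ⟨c, hc, h'⟩ :=
      exists_length_between hD' (mk_eq_mk_iff.1 h) t (by omega) (by omega)
    exact ⟨c.length, mem_unionOf_lengthSystem.2 ⟨a, c, mk_eq_mk_iff.2 hc, rfl, rfl⟩,
      by omega, by omega⟩
  refine ⟨D, fun k l₁ l₂ t h₁ h₂ ht₁ ht₂ => ?_⟩
  rcases le_total t k with htk | htk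
  · exact key h₁ (by omega) (by omega)
  · exact key h₂ (by omega) (by omega)

theorem exists_infinite_unionOf (h : ¬ IsBF R) : ∃ k, (unionOf (lengthSystem R) k).Infinite := by
  obtain ⟨a, ha⟩ := not_forall.1 h
  refine ⟨a.length, Set.Infinite.mono ?_ ha⟩
  rintro _ ⟨b, hb, rfl⟩
  exact mem_unionOf_lengthSystem.2 ⟨a, b, hb, rfl, rfl⟩

/-! ### Presentations of BF-monoids -/

theorem IsBF.length_eq_zero (h : IsBF R) {a : FreeMonoid X} (ha : PresentedMonoid.mk R a = 1) :
    a.length = 0 := by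
  by_contra hne
  have hpow : ∀ n : ℕ, (a ^ n).length = n * a.length := fun n => by
    induction n with
    | zero => simp
    | succ n ih => rw [pow_succ, FreeMonoid.length_mul, ih, Nat.succ_mul]
  refine Set.infinite_of_injective_forall_mem (f := fun n : ℕ => n * a.length)
    (fun m n hmn => Nat.eq_of_mul_eq_mul_right (Nat.pos_of_ne_zero hne) hmn) (fun n => ?_) (h 1)
  exact ⟨a ^ n, by simp [factorizations, ha], hpow n⟩

theorem IsBF.eq_one_of_isUnit (h : IsBF R) {a : FreeMonoid X}
    (ha : IsUnit (PresentedMonoid.mk R a)) : a = 1 := by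
  obtain ⟨m, hm⟩ := ha.exists_right_inv
  obtain ⟨b, rfl⟩ := PresentedMonoid.surjective_mk m
  rw [← map_mul] at hm
  have := h.length_eq_zero hm
  rw [FreeMonoid.length_mul] at this
  exact FreeMonoid.length_eq_zero.1 (by omega)

theorem IsBF.finite_irreducible [Finite X] (h : IsBF R) :
    {m : PresentedMonoid R | Irreducible m}.Finite := by
  refine (Set.finite_range (PresentedMonoid.of R)).subset fun m hm => ?_
  obtain ⟨a, rfl⟩ := PresentedMonoid.surjective_mk m
  induction a using FreeMonoid.casesOn with
  | one => exact absurd (map_one _) hm.ne_one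
  | of_mul x a =>
    rcases hm.isUnit_or_isUnit (map_mul _ _ _) with hu | hu
    · exact absurd (h.eq_one_of_isUnit hu) (FreeMonoid.of_ne_one x)
    · exact ⟨x, by rw [h.eq_one_of_isUnit hu, mul_one]; rfl⟩

/-- The maximal length is superadditive on products and positive on nonunits, so it drops in a
proper factorization. -/
theorem IsBF.closure_irreducible (h : IsBF R) :
    Submonoid.closure {m : PresentedMonoid R | Irreducible m} = ⊤ := by
  have hne : ∀ a, (lengthSet R a).Nonempty := fun a => ⟨_, a, rfl, rfl⟩
  have key : ∀ (n : ℕ) (a : FreeMonoid X), sSup (lengthSet R a) = n →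
      PresentedMonoid.mk R a ∈ Submonoid.closure {m : PresentedMonoid R | Irreducible m} := by
    intro n
    induction n using Nat.strong_induction_on with
    | _ n ih =>
      rintro a rfl
      by_cases hu : IsUnit (PresentedMonoid.mk R a)
      · rw [h.eq_one_of_isUnit hu, map_one]; exact one_mem _
      rcases irreducible_or_factor hu with hirr | ⟨m₁, m₂, h₁, h₂, e⟩
      · exact Submonoid.subset_closure hirr
      obtain ⟨b, rfl⟩ := PresentedMonoid.surjective_mk m₁
      obtain ⟨c, rfl⟩ := PresentedMonoid.surjective_mk m₂
      have hpos : ∀ d, ¬ IsUnit (PresentedMonoid.mk R d) → 0 < sSup (lengthSet R d) := by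
        intro d hd
        have h1 : d.length ≤ sSup (lengthSet R d) := le_csSup (h d).bddAbove ⟨d, rfl, rfl⟩
        have h2 : d.length ≠ 0 := fun h0 => hd (by
          rw [FreeMonoid.length_eq_zero.1 h0, map_one]; exact isUnit_one)
        omega
      have hb := hpos b h₁
      have hc := hpos c h₂
      obtain ⟨b', hb', eb⟩ := Nat.sSup_mem (hne b) (h b).bddAbove
      obtain ⟨c', hc', ec⟩ := Nat.sSup_mem (hne c) (h c).bddAbove
      have hle : (b' * c').length ≤ sSup (lengthSet R a) :=
        le_csSup (h a).bddAbove ⟨b' * c', by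
          change PresentedMonoid.mk R a = PresentedMonoid.mk R (b' * c')
          rw [e, map_mul, ← show _ = _ from hb', ← show _ = _ from hc'], rfl⟩
      rw [FreeMonoid.length_mul] at hle
      rw [e]
      exact mul_mem (ih _ (by omega) b rfl) (ih _ (by omega) c rfl)
  refine eq_top_iff.2 fun m _ => ?_
  obtain ⟨a, rfl⟩ := PresentedMonoid.surjective_mk m
  exact key _ a rfl

/-- Count the letters of `a` according to their type `(x, φ)`, where `φ` is conjugation by the part
of `a` to the right of the letter: letters of one type can be pulled out to the right without
changing the remaining letters. -/
theorem exists_letter_count [Fintype X] {φ : PresentedMonoid R → MulAut (PresentedMonoid R)}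
    (hφ : ∀ u m, m * u = u * φ u m) [Fintype (Set.range φ)] (a : FreeMonoid X) :
    ∃ c : X × Set.range φ → ℕ, ∑ t, c t = a.length ∧ ∀ t, ∀ j ≤ c t, ∃ a',
      PresentedMonoid.mk R a = PresentedMonoid.mk R a' * (t.2.1 (PresentedMonoid.of R t.1)) ^ j ∧
      a'.length + j = a.length := by
  classical
  induction a using FreeMonoid.inductionOn' with
  | one => exact ⟨0, by simp, fun t j hj => ⟨1, by simp [Nat.le_zero.1 hj]⟩⟩
  | of_mul x a ih =>
    obtain ⟨c, hc, ih⟩ := ih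
    set t₀ : X × Set.range φ := (x, ⟨_, PresentedMonoid.mk R a, rfl⟩)
    refine ⟨c + Pi.single t₀ 1, ?_, fun t j hj => ?_⟩
    · simp only [Pi.add_apply, Finset.sum_add_distrib, hc, Finset.sum_pi_single',
        Finset.mem_univ, if_true, FreeMonoid.length_mul, FreeMonoid.length_of]
      exact add_comm _ _
    · by_cases hjc : j ≤ c t
      · obtain ⟨a', h1, h2⟩ := ih t j hjc
        refine ⟨FreeMonoid.of x * a', by rw [map_mul, map_mul, h1, mul_assoc], ?_⟩
        rw [FreeMonoid.length_mul, FreeMonoid.length_mul, ← h2, add_assoc]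
      -- Here the new letter is pulled out too: moved across `a`, it becomes exactly the factor
      -- attached to `t₀`.
      · have ht : t = t₀ := by
          by_contra hne
          rw [Pi.add_apply, Pi.single_eq_of_ne hne] at hj
          exact hjc hj
        subst ht
        rw [Pi.add_apply, Pi.single_eq_same] at hj
        obtain ⟨a', h1, h2⟩ := ih t₀ (c t₀) le_rfl
        refine ⟨a', ?_, ?_⟩
        · rw [map_mul, hφ, show j = c t₀ + 1 by omega, pow_succ, ← mul_assoc, ← h1]
          rfl
        · rw [FreeMonoid.length_mul, FreeMonoid.length_of]
          omega

theorem exists_pow_card_mul [Finite X] [IsCancelMul (PresentedMonoid R)]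
    (hn : IsNormalizing (PresentedMonoid R)) [Finite (MulAut (PresentedMonoid R))] :
    ∃ B : ℕ, ∀ a : FreeMonoid X, B ≤ a.length → ∃ x a',
      PresentedMonoid.mk R a = PresentedMonoid.mk R a' *
        PresentedMonoid.of R x ^ Nat.card (MulAut (PresentedMonoid R)) ∧
      a'.length + Nat.card (MulAut (PresentedMonoid R)) = a.length := by
  choose φ hφ using hn.exists_mulAut
  have := Fintype.ofFinite X
  have := Fintype.ofFinite (Set.range φ)
  set N := Nat.card (MulAut (PresentedMonoid R))
  refine ⟨Fintype.card (X × Set.range φ) * N + 1, fun a ha => ?_⟩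
  obtain ⟨c, hc, h⟩ := exists_letter_count hφ a
  obtain ⟨⟨x, ⟨_, u, rfl⟩⟩, hu⟩ : ∃ t, N ≤ c t := by
    by_contra! hlt
    have := Finset.sum_le_card_nsmul Finset.univ c N fun t _ => (hlt t).le
    rw [hc, smul_eq_mul, Finset.card_univ] at this
    omega
  obtain ⟨a', h1, h2⟩ := h _ N hu
  refine ⟨x, a', ?_, h2⟩
  -- The extracted power is a conjugate of `x ^ N`, which is central and hence fixed.
  have hcen := Submonoid.mem_center_iff.1
    (pow_card_mulAut_mem_center (hφ (PresentedMonoid.of R x))) u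
  rw [h1, ← map_pow]
  congr 1
  apply mul_left_cancel (a := u)
  rw [← hφ, ← hcen]

open scoped Classical in
theorem IsBF.exists_isElasticity [Finite X] [Nonempty X] [IsCancelMul (PresentedMonoid R)]
    (hn : IsNormalizing (PresentedMonoid R)) (h : IsBF R) :
    ∃ p q, IsElasticity (lengthSystem R) p q := by
  have := finite_mulAut h.finite_irreducible h.closure_irreducible
  have := Fintype.ofFinite X
  obtain ⟨B, hB⟩ := exists_pow_card_mul hn
  set N := Nat.card (MulAut (PresentedMonoid R))
  have hN : 0 < N := Nat.card_pos
  have hz : ∀ x, PresentedMonoid.of R x ^ N ∈ Submonoid.center (PresentedMonoid R) := fun x =>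
    pow_card_mulAut_mem_center (hn.exists_mulAut _).choose_spec
  let Z : (X → ℕ) → Submonoid.center (PresentedMonoid R) := fun u => ∏ x, ⟨_, hz x⟩ ^ u x
  have hZzero : Z 0 = 1 := by
    simp only [Z, Pi.zero_apply, pow_zero, Finset.prod_const_one]
  have hZadd : ∀ u v, Z (u + v) = Z u * Z v := fun u v => by
    simp only [Z, Pi.add_apply, pow_add, Finset.prod_mul_distrib]
  have hZsingle : ∀ x, (Z (Pi.single x 1) : PresentedMonoid R) = PresentedMonoid.of R x ^ N := by
    intro x
    have : Z (Pi.single x 1) = ⟨_, hz x⟩ := by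
      simp only [Z]
      rw [Finset.prod_eq_single x] <;> simp +contextual
    rw [this]
  have hZcomm : ∀ u m, (Z u : PresentedMonoid R) * m = m * Z u := fun u m =>
    (Submonoid.mem_center_iff.1 (Z u).2 m).symm
  have hpow : ∀ x n, ((FreeMonoid.of x : FreeMonoid X) ^ n).length = n := fun x n => by
    induction n with
    | zero => simp
    | succ n ih => rw [pow_succ, FreeMonoid.length_mul, ih, FreeMonoid.length_of]
  have hZword : ∀ u, ∃ w, PresentedMonoid.mk R w = Z u ∧ w.length = N * ∑ x, u x := by
    intro u
    suffices H : ∀ s : Finset X, ∃ w, PresentedMonoid.mk R w =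
        (∏ x ∈ s, (⟨_, hz x⟩ : Submonoid.center (PresentedMonoid R)) ^ u x :
          Submonoid.center (PresentedMonoid R)) ∧ w.length = N * ∑ x ∈ s, u x from H _
    intro s
    induction s using Finset.induction_on with
    | empty => exact ⟨1, by simp⟩
    | insert x s hx ih =>
      obtain ⟨w, h1, h2⟩ := ih
      refine ⟨FreeMonoid.of x ^ (N * u x) * w, ?_, ?_⟩
      · rw [Finset.prod_insert hx, map_mul, h1, map_pow, pow_mul]
        rfl
      · rw [Finset.sum_insert hx, FreeMonoid.length_mul, h2, hpow, mul_add]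
  have hdec : ∀ (n : ℕ) (a : FreeMonoid X), a.length = n → ∃ u r, r.length < B + 1 ∧
      a.length = N * ∑ x, u x + r.length ∧
      PresentedMonoid.mk R a = Z u * PresentedMonoid.mk R r := by
    intro n
    induction n using Nat.strong_induction_on with
    | _ n ih =>
      rintro a rfl
      by_cases ha : B ≤ a.length
      · obtain ⟨x, a', h1, h2⟩ := hB a ha
        obtain ⟨u, r, h3, h4, h5⟩ := ih a'.length (by omega) a' rfl
        refine ⟨u + Pi.single x 1, r, h3, ?_, ?_⟩
        · simp only [Pi.add_apply, Finset.sum_add_distrib, Finset.sum_pi_single',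
            Finset.mem_univ, if_true]
          rw [← h2, h4]
          ring
        · rw [h1, h5, hZadd, Submonoid.coe_mul, mul_assoc, mul_assoc, ← hZsingle, hZcomm (Pi.single x 1)]
      · exact ⟨0, a, by omega, by simp, by rw [hZzero, Submonoid.coe_one, one_mul]⟩
  -- Exponent pairs for fixed remainders; positivity makes each split-off generator lower the index.
  let S : FreeMonoid X → FreeMonoid X → Set ((X → ℕ) × (X → ℕ)) := fun r s =>
    {w | (Z w.1 : PresentedMonoid R) * PresentedMonoid.mk R r = Z w.2 * PresentedMonoid.mk R s ∧
      0 < N * ∑ x, w.1 x + r.length}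
  let W : Set (FreeMonoid X) := {r | r.length < B + 1}
  have hW : W.Finite := List.finite_length_lt X (B + 1)
  let F : Set (ℕ × ℕ) := ⋃ r ∈ W, ⋃ s ∈ W,
    (fun w : (X → ℕ) × (X → ℕ) => (N * ∑ x, w.1 x + r.length, N * ∑ x, w.2 x + s.length)) ''
      {w | Minimal (· ∈ S r s) w}
  have hwqo : ∀ T : Set ((X → ℕ) × (X → ℕ)), T.IsPWO := fun T => Set.isPWO_of_wellQuasiOrderedLE T
  refine isSubadditive_lengthSystem.exists_isElasticity ?_ (F := F) ?_ ?_ ?_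
  · intro l hl
    obtain ⟨a, b, e, ha, rfl⟩ := mem_unionOf_lengthSystem.1 hl
    rw [FreeMonoid.length_eq_zero.1 ha, map_one] at e
    exact h.length_eq_zero e.symm
  · refine hW.biUnion fun r _ => hW.biUnion fun s _ => Set.Finite.image _ ?_
    exact (setOfPred_minimal_antichain _).finite_of_partiallyWellOrderedOn (hwqo _)
  · simp only [F, Set.mem_iUnion]
    rintro _ ⟨r, -, s, -, ⟨u, v⟩, hw, rfl⟩
    obtain ⟨a, ha, ha'⟩ := hZword u
    obtain ⟨b, hb, hb'⟩ := hZword v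
    refine ⟨mem_unionOf_lengthSystem.2 ⟨a * r, b * s, ?_, ?_, ?_⟩, hw.1.2⟩
    · rw [map_mul, map_mul, ha, hb]; exact hw.1.1
    · rw [FreeMonoid.length_mul, ha']
    · rw [FreeMonoid.length_mul, hb']
  · intro k l hl hk
    obtain ⟨a, b, e, rfl, rfl⟩ := mem_unionOf_lengthSystem.1 hl
    obtain ⟨u, r, hr, hur, hua⟩ := hdec _ a rfl
    obtain ⟨v, s, hs, hvs, hvb⟩ := hdec _ b rfl
    obtain ⟨⟨u₀, v₀⟩, ⟨hu, hv⟩, hmin⟩ := (hwqo (S r s)).exists_le_minimal (a := (u, v))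
      ⟨by rw [← hua, ← hvb, e], by rw [← hur]; exact hk⟩
    obtain ⟨u₁, rfl⟩ := exists_add_of_le (show u₀ ≤ u from hu)
    obtain ⟨v₁, rfl⟩ := exists_add_of_le (show v₀ ≤ v from hv)
    obtain ⟨a₁, ha, ha'⟩ := hZword u₁
    obtain ⟨b₁, hb, hb'⟩ := hZword v₁
    refine ⟨_, Set.mem_biUnion hr (Set.mem_biUnion hs ⟨_, hmin, rfl⟩), a₁.length, b₁.length,
      mem_unionOf_lengthSystem.2 ⟨a₁, b₁, ?_, rfl, rfl⟩, ?_, ?_⟩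
    -- Cancelling the minimal relation `Z u₀ * r = Z v₀ * s` leaves `Z u₁ = Z v₁`.
    · rw [ha, hb]
      rw [hua, hvb, hZadd, hZadd, mul_comm (Z u₀), mul_comm (Z v₀), Submonoid.coe_mul,
        Submonoid.coe_mul, mul_assoc, mul_assoc, hmin.1.1] at e
      exact mul_right_cancel e
    · rw [hur, ha']
      simp only [Pi.add_apply, Finset.sum_add_distrib]
      ring
    · rw [hvs, hb']
      simp only [Pi.add_apply, Finset.sum_add_distrib]
      ring

end Presented

end LengthFactorization

theorem theorem5p5 {X : Type*} [Finite X] [Nonempty X]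
    (R : FreeMonoid X → FreeMonoid X → Prop)
    (hR : {z : ℤ | ∃ a b : FreeMonoid X, R a b ∧ z = (a.length : ℤ) - (b.length : ℤ)}.Finite)
    (hnorm : LengthFactorization.IsNormalizing (PresentedMonoid R))
    (hcanc : IsCancelMul (PresentedMonoid R)) :
    LengthFactorization.StructureForUnions (LengthFactorization.lengthSystem R) ∧
    (LengthFactorization.IsBF R →
      LengthFactorization.StrongStructureForUnions (LengthFactorization.lengthSystem R)) := by
  obtain ⟨D, hD⟩ := LengthFactorization.exists_hasGapsLE hR
  have hsub := LengthFactorization.isSubadditive_lengthSystem (R := R)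
  have hBF : LengthFactorization.IsBF R →
      LengthFactorization.StrongStructureForUnions (LengthFactorization.lengthSystem R) := fun h =>
    have ⟨_, _, he⟩ := h.exists_isElasticity hnorm
    he.strongStructureForUnions hsub hD
  refine ⟨?_, hBF⟩
  by_cases h : LengthFactorization.IsBF R
  · exact (hBF h).1
  · obtain ⟨k, hk⟩ := LengthFactorization.exists_infinite_unionOf h
    exact LengthFactorization.structureForUnions_of_isClose hsub hD
      (LengthFactorization.isClose_of_infinite hsub hD hk)
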